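/- **Conventions.** Let $\overline{\mathbb R}=[-\infty,\infty]$. A function $\psi:\mathbb R^d\to\overline{\mathbb R}$ is *proper* if $\psi(x)<\infty$ for some $x$ and $\psi(x)>-\infty$ for all $x$; it is convex if its epigraph is convex; and $\operatorname{argmin}\psi=\{x : \psi(x)<\infty,\ \psi(x)\le\inf\psi\}$. A vector $v$ is a *regular subgradient* of $\psi$ at $x$ if $\psi(x)$ is finite and $\psi(z)\ge\psi(x)+\langle v,z-x\rangle+o(\|z-x\|)$ as $z\to x$. If $\psi(x)$ is finite, $\partial\psi(x)$ is the set of all $v$ for which there are $x^k\to x$ with $\psi(x^k)\to\psi(x)$ and regular subgradients $v^k$ of $\psi$ at $x^k$ with $v^k\to v$; otherwise $\partial\psi(x)=\emptyset$. Put $\operatorname{gph}\partial\psi=\{(x,v): v\in\partial\psi(x)\}$. For sets $S^\nu$, $\operatorname{LimOut} S^\nu$ is the set of all limits of points $z^\nu\in S^\nu$, $\nu\in N$, along subsequences $N\subset\mathbb N$. The functions $\psi^\nu$ *epi-converge* to $\psi$ if $\liminf\psi^\nu(x^\nu)\ge\psi(x)$ whenever $x^\nu\to x$, and for every $x$ there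 is $x^\nu\to x$ with $\limsup\psi^\nu(x^\nu)\le\psi(x)$. All norms and distances are Euclidean, and $\operatorname{dist}(\cdot,\emptyset)=\infty$. Given $\phi:\mathbb R^n\to\overline{\mathbb R}$, a function $f:\mathbb R^m\times\mathbb R^n\to\overline{\mathbb R}$ is a *Rockafellian with anchor* $\bar u\in\mathbb R^m$ for the problem of minimizing $\phi$ if $f(\bar u,x)=\phi(x)$ for all $x$. It is *exact* for $\bar y\in\mathbb R^m$ if $x^\star\in\operatorname{argmin}\phi$ implies $(\bar u,x^\star)\in\operatorname{argmin}_{u,x}\{f(u,x)-\langle\bar y,u-\bar u\rangle\}$. It is *strictly exact* for $\bar y$ if, in addition, $(u^\star,x^\star)\in\operatorname{argmin}_{u,x}\{f(u,x)-\langle\bar y,u-\bar u\rangle\}$ implies $u^\star=\bar u$ and $x^\star\in\operatorname{argmin}\phi$. Functions $f^\nu$ are *asymptotically strictly exact Rockafellians* for $\bar y$ with limit $f$ if they epi-converge to $f$ and $f$ is a strictly exact Rockafellian for $\bar y$. **Theorem** (convergence to first-order optimality condition). Let $\phi:\mathbb R^n\to\overline{\mathbb R}$ be proper, let $y^\nu\to\bar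 y$ in $\mathbb R^m$ and $\epsilon^\nu\to0$ with $\epsilon^\nu\ge0$, and let $f:\mathbb R^m\times\mathbb R^n\to\overline{\mathbb R}$ be a Rockafellian with anchor $\bar u$ for the problem of minimizing $\phi$ that is exact for $\bar y$. Let $f^\nu:\mathbb R^m\times\mathbb R^n\to\overline{\mathbb R}$, $\nu\in\mathbb N$. (a) Suppose that $$\operatorname{LimOut}(\operatorname{gph}\partial f^\nu)\subset\operatorname{gph}\partial f \qquad (*)$$ and that $(u^\nu,x^\nu)$ satisfies $\operatorname{dist}\big((y^\nu,0),\partial f^\nu(u^\nu,x^\nu)\big)\le\epsilon^\nu$ for every $\nu$. Then every cluster point $(\hat u,\hat x)$ of $\{(u^\nu,x^\nu)\}$ satisfies $(\bar y,0)\in\partial f(\hat u,\hat x)$. (b) Suppose instead of $(*)$ that the $f^\nu$ are proper, lower semicontinuous and convex, and that they are asymptotically strictly exact Rockafellians for $\bar y$ with limit $f$ (with the same anchor $\bar u$). Then $(*)$ holds. Moreover, if $\operatorname{dist}\big((y^\nu,0),\partial f^\nu(u^\nu,x^\nu)\big)\le\epsilon^\nu$ for every $\nu$, then every cluster point $(\hat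 u,\hat x)$ of $\{(u^\nu,x^\nu)\}$ satisfies $\hat u=\bar u$ and $\hat x\in\operatorname{argmin}\phi$. -/

import Mathlib

open Filter Topology

namespace Rockafellian

/-- `ℝᵐ × ℝⁿ` with its Euclidean norm and inner product. -/
abbrev Joint (m n : ℕ) : Type :=
  WithLp 2 (EuclideanSpace ℝ (Fin m) × EuclideanSpace ℝ (Fin n))

/-- The pair `(u, x)` as a point of `ℝᵐ × ℝⁿ`. -/
abbrev pair {m n : ℕ} (u : EuclideanSpace ℝ (Fin m)) (x : EuclideanSpace ℝ (Fin n)) :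
    Joint m n :=
  WithLp.toLp 2 (u, x)

section General

variable {E : Type*}

/-- Proper: finite somewhere from above, and nowhere equal to `-∞`. -/
def IsProper (ψ : E → EReal) : Prop :=
  (∃ x, ψ x < ⊤) ∧ ∀ x, ⊥ < ψ x

/-- The set of minimizers, taken within the effective domain `{x | ψ x < ∞}`. -/
def argmin (ψ : E → EReal) : Set E :=
  {x | ψ x < ⊤ ∧ ψ x ≤ ⨅ z, ψ z}

/-- Convexity of an extended real-valued function: its epigraph is a convex set. -/
def IsConvexFun [AddCommGroup E] [Module ℝ E] (ψ : E → EReal) : Prop :=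
  Convex ℝ {p : E × ℝ | ψ p.1 ≤ (p.2 : EReal)}

/-- Epi-convergence of `ψs ν` to `ψ` as `ν → ∞`. -/
def EpiConverges [TopologicalSpace E] (ψs : ℕ → E → EReal) (ψ : E → EReal) : Prop :=
  (∀ (x : E) (xs : ℕ → E), Tendsto xs atTop (𝓝 x) →
      ψ x ≤ liminf (fun ν => ψs ν (xs ν)) atTop) ∧
  (∀ x : E, ∃ xs : ℕ → E, Tendsto xs atTop (𝓝 x) ∧
      limsup (fun ν => ψs ν (xs ν)) atTop ≤ ψ x)

/-- The outer limit of a sequence of sets: all limits of points `zs j ∈ S (k j)` along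
subsequences `k 0 < k 1 < ⋯` of the indices. -/
def limOut [TopologicalSpace E] (S : ℕ → Set E) : Set E :=
  {z | ∃ k : ℕ → ℕ, StrictMono k ∧
    ∃ zs : ℕ → E, (∀ j, zs j ∈ S (k j)) ∧ Tendsto zs atTop (𝓝 z)}

variable [NormedAddCommGroup E] [InnerProductSpace ℝ E]

/-- `v` is a regular (Fréchet) subgradient of `ψ` at `x`: `ψ x` is finite and
`ψ z ≥ ψ x + ⟪v, z - x⟫ + o(‖z - x‖)` as `z → x`. -/
def IsRegularSubgradient (ψ : E → EReal) (x v : E) : Prop :=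
  ψ x ≠ ⊥ ∧ ψ x ≠ ⊤ ∧
    ∀ δ : ℝ, 0 < δ →
      ∀ᶠ z in 𝓝 x, ψ x + ((inner ℝ v (z - x) - δ * ‖z - x‖ : ℝ) : EReal) ≤ ψ z

/-- The set `∂ψ(x)` of (general, limiting) subgradients: limits of regular subgradients at
points `xs j → x` with `ψ (xs j) → ψ x`; it is empty when `ψ x` is not finite. -/
def subgradients (ψ : E → EReal) (x : E) : Set E :=
  {v | ψ x ≠ ⊥ ∧ ψ x ≠ ⊤ ∧
    ∃ (xs vs : ℕ → E), Tendsto xs atTop (𝓝 x) ∧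
      Tendsto (fun j => ψ (xs j)) atTop (𝓝 (ψ x)) ∧
      Tendsto vs atTop (𝓝 v) ∧ ∀ j, IsRegularSubgradient ψ (xs j) (vs j)}

/-- The graph of the subgradient mapping `∂ψ`. -/
def gphSubgradients (ψ : E → EReal) : Set (E × E) :=
  {p | p.2 ∈ subgradients ψ p.1}

end General

variable {m n : ℕ}

/-- `f` is a Rockafellian with anchor `ubar` for the problem of minimizing `φ`. -/
def IsRockafellian (f : Joint m n → EReal) (φ : EuclideanSpace ℝ (Fin n) → EReal)
    (ubar : EuclideanSpace ℝ (Fin m)) : Prop :=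
  ∀ x, f (pair ubar x) = φ x

/-- The objective function `(u, x) ↦ f(u, x) - ⟪ybar, u - ubar⟫` of the relaxed problem. -/
noncomputable def relaxed (f : Joint m n → EReal)
    (ubar ybar : EuclideanSpace ℝ (Fin m)) : Joint m n → EReal :=
  fun z => f z - ((inner ℝ ybar (z.fst - ubar) : ℝ) : EReal)

/-- `f` is an exact Rockafellian with anchor `ubar` for the multiplier vector `ybar`. -/
def IsExact (f : Joint m n → EReal) (φ : EuclideanSpace ℝ (Fin n) → EReal)
    (ubar ybar : EuclideanSpace ℝ (Fin m)) : Prop :=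
  IsRockafellian f φ ubar ∧
    ∀ x ∈ argmin φ, pair ubar x ∈ argmin (relaxed f ubar ybar)

/-- `f` is a strictly exact Rockafellian with anchor `ubar` for `ybar`. -/
def IsStrictlyExact (f : Joint m n → EReal) (φ : EuclideanSpace ℝ (Fin n) → EReal)
    (ubar ybar : EuclideanSpace ℝ (Fin m)) : Prop :=
  IsExact f φ ubar ybar ∧
    ∀ u x, pair u x ∈ argmin (relaxed f ubar ybar) → u = ubar ∧ x ∈ argmin φ

/-- The functions `fs ν` are asymptotically strictly exact Rockafellians for `ybar`, with the
Rockafellian `f` (anchor `ubar`) being their limit. -/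
def AsymptoticallyStrictlyExact (fs : ℕ → Joint m n → EReal) (f : Joint m n → EReal)
    (φ : EuclideanSpace ℝ (Fin n) → EReal) (ubar ybar : EuclideanSpace ℝ (Fin m)) : Prop :=
  EpiConverges fs f ∧ IsStrictlyExact f φ ubar ybar

/-- `(us ν, xs ν)` solves `(ys ν, 0) ∈ ∂(fs ν)(u, x)` with tolerance `ε ν`, for every `ν`.
The distance to the empty set is `∞`. -/
def SolvesWithTolerance (fs : ℕ → Joint m n → EReal) (ys : ℕ → EuclideanSpace ℝ (Fin m))
    (ε : ℕ → ℝ) (us : ℕ → EuclideanSpace ℝ (Fin m)) (xs : ℕ → EuclideanSpace ℝ (Fin n)) : Prop :=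
  ∀ ν, Metric.infEDist (pair (ys ν) (0 : EuclideanSpace ℝ (Fin n)))
    (subgradients (fs ν) (pair (us ν) (xs ν))) ≤ ENNReal.ofReal (ε ν)

end Rockafellian

/-!
For convex functions every subgradient `v` at `x`, regular or limiting, satisfies the global
inequality `ψ x + ⟪v, w - x⟫ ≤ ψ w` (`IsConvexFun.le_of_mem_subgradients`). This inequality is
inherited by epi-limits (`EpiConverges.add_inner_le_of_mem_limOut`): the left-hand sides are bounded
below by the liminf condition along `zs j → z`, the right-hand sides above by a recovery sequence
for `w`. Conversely, the global inequality at a point of finiteness is a subgradient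
(`mem_subgradients_of_forall_le`). An epi-limit of convex functions that is finite at one point
never takes the value `-∞` (`EpiConverges.ne_bot_of_isConvexFun`), and the inequality itself rules
out `+∞`, so the outer limit of the subgradient graphs lies in the graph of the limit's
subgradient mapping.

Approximate solutions of the optimality condition, together with nearly closest subgradients,
produce a point of the outer limit over each cluster point (`mem_limOut_of_mapClusterPt`). In the
convex case the global inequality for the vector `(ybar, 0)` says precisely that the cluster point
minimizes the relaxed problem, and strict exactness finishes the argument.
-/

namespace Rockafellian

section Subgradients

variable {E : Type*} [NormedAddCommGroup E] [InnerProductSpace ℝ E] {ψ : E → EReal} {x v w : E}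

/-! ### Subgradients of convex functions -/

theorem IsConvexFun.le_of_le_coe (hψ : IsConvexFun ψ) {a b t : ℝ} (hx : ψ x ≤ a) (hw : ψ w ≤ b)
    (ht0 : 0 ≤ t) (ht1 : t ≤ 1) :
    ψ (x + t • (w - x)) ≤ ((a + t * (b - a) : ℝ) : EReal) := by
  have h := hψ (show (x, a) ∈ {p : E × ℝ | ψ p.1 ≤ (p.2 : EReal)} from hx)
    (show (w, b) ∈ {p : E × ℝ | ψ p.1 ≤ (p.2 : EReal)} from hw)
    (sub_nonneg.2 ht1) ht0 (by ring)
  have h1 : x + t • (w - x) = (1 - t) • x + t • w := by module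
  have h2 : a + t * (b - a) = (1 - t) * a + t * b := by ring
  rw [h1, h2]
  simpa using h

/-- For convex functions the local first-order estimate propagates to the whole space, by
comparing it with convexity along the segment from `x` to `w`. -/
theorem IsRegularSubgradient.add_inner_le (hv : IsRegularSubgradient ψ x v)
    (hψ : IsConvexFun ψ) (w : E) : ψ x + ((inner ℝ v (w - x) : ℝ) : EReal) ≤ ψ w := by
  obtain ⟨hbot, htop, hloc⟩ := hv
  lift ψ x to ℝ using ⟨htop, hbot⟩ with c hc
  refine EReal.le_of_forall_lt_iff_le.1 fun d hd => ?_
  rw [← EReal.coe_add, EReal.coe_le_coe_iff]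
  have key : ∀ δ : ℝ, 0 < δ → c + (inner ℝ v (w - x) - δ * ‖w - x‖) ≤ d := by
    intro δ hδ
    have hlim : Tendsto (fun t : ℝ => x + t • (w - x)) (𝓝[>] 0) (𝓝 x) := by
      have : Continuous fun t : ℝ => x + t • (w - x) := by fun_prop
      simpa using (this.tendsto 0).mono_left nhdsWithin_le_nhds
    have h1 : ∀ᶠ t : ℝ in 𝓝[>] 0, t < 1 :=
      nhdsWithin_le_nhds (eventually_lt_nhds one_pos)
    obtain ⟨t, ht, ht1, ht0⟩ :=
      ((hlim.eventually (hloc δ hδ)).and (h1.and self_mem_nhdsWithin)).exists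
    have ht0 : 0 < t := ht0
    have h := ht.trans (hψ.le_of_le_coe hc.symm.le hd.le ht0.le ht1.le)
    rw [← EReal.coe_add, EReal.coe_le_coe_iff, add_sub_cancel_left, inner_smul_right,
      norm_smul, Real.norm_of_nonneg ht0.le] at h
    refine le_of_mul_le_mul_left ?_ ht0
    linarith
  have hlim : Tendsto (fun δ : ℝ => c + (inner ℝ v (w - x) - δ * ‖w - x‖)) (𝓝[>] 0)
      (𝓝 (c + inner ℝ v (w - x))) := by
    have : Continuous fun δ : ℝ => c + (inner ℝ v (w - x) - δ * ‖w - x‖) := by fun_prop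
    simpa using (this.tendsto 0).mono_left nhdsWithin_le_nhds
  exact le_of_tendsto hlim (eventually_mem_nhdsWithin.mono fun δ hδ => key δ hδ)

theorem IsConvexFun.le_of_mem_subgradients (hψ : IsConvexFun ψ) (hv : v ∈ subgradients ψ x)
    (w : E) : ψ x + ((inner ℝ v (w - x) : ℝ) : EReal) ≤ ψ w := by
  obtain ⟨-, -, xs, vs, hxs, hψxs, hvs, hreg⟩ := hv
  have hinner : Tendsto (fun j => ((inner ℝ (vs j) (w - xs j) : ℝ) : EReal)) atTop
      (𝓝 ((inner ℝ v (w - x) : ℝ) : EReal)) :=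
    (continuous_coe_real_ereal.tendsto _).comp (hvs.inner (tendsto_const_nhds.sub hxs))
  have hadd := (EReal.continuousAt_add (p := (ψ x, ((inner ℝ v (w - x) : ℝ) : EReal)))
    (Or.inr (EReal.coe_ne_bot _)) (Or.inr (EReal.coe_ne_top _))).tendsto.comp
    (hψxs.prodMk_nhds hinner)
  exact le_of_tendsto' hadd fun j => (hreg j).add_inner_le hψ w

theorem mem_subgradients_of_forall_le (hbot : ψ x ≠ ⊥) (htop : ψ x ≠ ⊤)
    (h : ∀ w, ψ x + ((inner ℝ v (w - x) : ℝ) : EReal) ≤ ψ w) : v ∈ subgradients ψ x := by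
  refine ⟨hbot, htop, fun _ => x, fun _ => v, tendsto_const_nhds, tendsto_const_nhds,
    tendsto_const_nhds, fun _ => ⟨hbot, htop, fun δ hδ => Eventually.of_forall fun w => ?_⟩⟩
  refine le_trans (add_le_add_right (EReal.coe_le_coe_iff.2 ?_) _) (h w)
  exact sub_le_self _ (by positivity)

end Subgradients

/-! ### Epi-limits -/

section EpiLimits

/-- A convergent sequence indexed by a subsequence of `ℕ` extends, by its limit, to a convergent
sequence indexed by `ℕ`. -/
theorem tendsto_extend_of_strictMono {X : Type*} [TopologicalSpace X] {k : ℕ → ℕ}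
    (hk : StrictMono k) {zs : ℕ → X} {z : X} (hzs : Tendsto zs atTop (𝓝 z)) :
    Tendsto (Function.extend k zs fun _ => z) atTop (𝓝 z) := by
  refine tendsto_def.2 fun U hU => ?_
  obtain ⟨J, hJ⟩ := eventually_atTop.1 (hzs.eventually hU)
  refine eventually_atTop.2 ⟨k J, fun ν hν => ?_⟩
  by_cases h : ∃ j, k j = ν
  · obtain ⟨j, rfl⟩ := h
    rw [hk.injective.extend_apply]
    exact hJ j (hk.le_iff_le.1 hν)
  · rw [Function.extend_apply' _ _ _ h]
    exact mem_of_mem_nhds hU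

theorem EpiConverges.eventually_lt_of_subseq {X : Type*} [TopologicalSpace X]
    {ψs : ℕ → X → EReal} {ψ : X → EReal} (h : EpiConverges ψs ψ) {k : ℕ → ℕ} (hk : StrictMono k)
    {zs : ℕ → X} {z : X} (hzs : Tendsto zs atTop (𝓝 z)) {a : EReal} (ha : a < ψ z) :
    ∀ᶠ j in atTop, a < ψs (k j) (zs j) := by
  have h1 := eventually_lt_of_lt_liminf
    (ha.trans_le (h.1 z _ (tendsto_extend_of_strictMono hk hzs)))
  filter_upwards [hk.tendsto_atTop.eventually h1] with j hj
  rwa [hk.injective.extend_apply] at hj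

variable {E : Type*} [NormedAddCommGroup E] [InnerProductSpace ℝ E]
  {ψs : ℕ → E → EReal} {ψ : E → EReal}

/-- If the limit were `-∞` at `z`, then moving a recovery sequence for the point `p` of finiteness
slightly towards a recovery sequence for `z` would give points converging to `p` along which
the functions tend to `-∞`. -/
theorem EpiConverges.ne_bot_of_isConvexFun (h : EpiConverges ψs ψ)
    (hconv : ∀ ν, IsConvexFun (ψs ν)) (hproper : ∀ ν, IsProper (ψs ν)) {p : E}
    (hbot : ψ p ≠ ⊥) (htop : ψ p ≠ ⊤) (z : E) : ψ z ≠ ⊥ := by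
  intro hz
  obtain ⟨ps, hps, hψps⟩ := h.2 p
  obtain ⟨ws, hws, hψws⟩ := h.2 z
  lift ψ p to ℝ using ⟨htop, hbot⟩ with r hr
  have hp : ∀ᶠ ν in atTop, ψs ν (ps ν) < ((r + 1 : ℝ) : EReal) :=
    eventually_lt_of_limsup_lt (hψps.trans_lt (EReal.coe_lt_coe_iff.2 (lt_add_one r)))
  have hw : ∀ c : ℝ, ∀ᶠ ν in atTop, ψs ν (ws ν) < (c : EReal) := fun c =>
    eventually_lt_of_limsup_lt (hψws.trans_lt (hz ▸ EReal.bot_lt_coe c))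
  -- The step length `1 / b ν` tends to zero, while `(1 / b ν) * ψs ν (ws ν) = -b ν` tends to `-∞`.
  let b : ℕ → ℝ := fun ν => √(-(ψs ν (ws ν)).toReal)
  have hcoe : ∀ᶠ ν in atTop, ((ψs ν (ws ν)).toReal : EReal) = ψs ν (ws ν) := by
    filter_upwards [hw 0] with ν hν
    exact EReal.coe_toReal (hν.trans (EReal.coe_lt_top 0)).ne ((hproper ν).2 _).ne'
  have hb : Tendsto b atTop atTop := by
    refine Real.tendsto_sqrt_atTop.comp (tendsto_neg_atBot_atTop.comp ?_)
    refine tendsto_atBot.2 fun c => ?_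
    filter_upwards [hcoe, hw c] with ν hν hc
    rw [← hν, EReal.coe_lt_coe_iff] at hc
    exact hc.le
  have hq : Tendsto (fun ν => ps ν + (b ν)⁻¹ • (ws ν - ps ν)) atTop (𝓝 p) := by
    simpa using hps.add (hb.inv_tendsto_atTop.smul (hws.sub hps))
  have hlow := h.eventually_lt_of_subseq strictMono_id hq
    (show ((r - 1 : ℝ) : EReal) < ψ p from hr ▸ EReal.coe_lt_coe_iff.2 (sub_one_lt r))
  obtain ⟨ν, hν, hpν, hcν, hwν, hbν⟩ := (hlow.and (hp.and (hcoe.and ((hw 0).and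
    (hb.eventually_ge_atTop (|r + 1| + |r - 1| + 1)))))).exists
  have hb1 : 1 ≤ b ν := by linarith [abs_nonneg (r + 1), abs_nonneg (r - 1)]
  have hb0 : 0 < b ν := one_pos.trans_le hb1
  have hle := hν.trans_le ((hconv ν).le_of_le_coe hpν.le hcν.ge
    (inv_nonneg.2 hb0.le) (inv_le_one_of_one_le₀ hb1))
  rw [EReal.coe_lt_coe_iff] at hle
  have hneg : (ψs ν (ws ν)).toReal ≤ 0 := by
    rw [← hcν, EReal.coe_lt_coe_iff] at hwν
    exact hwν.le
  have hsq : (ψs ν (ws ν)).toReal = -(b ν * b ν) := by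
    rw [Real.mul_self_sqrt (neg_nonneg.2 hneg), neg_neg]
  have hval : (b ν)⁻¹ * ((ψs ν (ws ν)).toReal - (r + 1)) = -b ν - (b ν)⁻¹ * (r + 1) := by
    rw [hsq]
    field_simp
  have hinv : (1 - (b ν)⁻¹) * (r + 1) ≤ |r + 1| :=
    calc (1 - (b ν)⁻¹) * (r + 1) ≤ (1 - (b ν)⁻¹) * |r + 1| :=
          mul_le_mul_of_nonneg_left (le_abs_self _)
            (sub_nonneg.2 (inv_le_one_of_one_le₀ hb1))
      _ ≤ 1 * |r + 1| :=
          mul_le_mul_of_nonneg_right (sub_le_self _ (inv_nonneg.2 hb0.le)) (abs_nonneg _)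
      _ = |r + 1| := one_mul _
  rw [hval] at hle
  linarith [neg_abs_le (r - 1)]

/-- The subgradient inequality of convex functions passes to the epi-limit. -/
theorem EpiConverges.add_inner_le_of_mem_limOut (h : EpiConverges ψs ψ)
    (hconv : ∀ ν, IsConvexFun (ψs ν)) {z v : E}
    (hzv : (z, v) ∈ limOut fun ν => gphSubgradients (ψs ν)) (w : E) :
    ψ z + ((inner ℝ v (w - z) : ℝ) : EReal) ≤ ψ w := by
  obtain ⟨k, hk, ps, hps, hlim⟩ := hzv
  have hz : Tendsto (fun j => (ps j).1) atTop (𝓝 z) := (continuous_fst.tendsto _).comp hlim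
  have hv : Tendsto (fun j => (ps j).2) atTop (𝓝 v) := (continuous_snd.tendsto _).comp hlim
  obtain ⟨ws, hws, hψws⟩ := h.2 w
  have hinner : Tendsto (fun j => inner ℝ (ps j).2 (ws (k j) - (ps j).1)) atTop
      (𝓝 (inner ℝ v (w - z))) := hv.inner ((hws.comp hk.tendsto_atTop).sub hz)
  by_contra! hlt
  obtain ⟨α, hα, hα'⟩ := EReal.lt_iff_exists_real_btwn.1 hlt
  obtain ⟨β, hβ, hβ'⟩ := EReal.lt_iff_exists_real_btwn.1 hα'
  rw [EReal.coe_lt_coe_iff] at hβ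
  have hlow : ((β - inner ℝ v (w - z) : ℝ) : EReal) < ψ z := by
    rw [EReal.coe_sub]
    exact EReal.sub_lt_of_lt_add hβ'
  have hup := hk.tendsto_atTop.eventually (eventually_lt_of_limsup_lt (hψws.trans_lt hα))
  have hc := hinner.eventually (eventually_gt_nhds
    (show inner ℝ v (w - z) - (β - α) < inner ℝ v (w - z) by linarith))
  obtain ⟨j, hj1, hj2, hj3⟩ :=
    ((h.eventually_lt_of_subseq hk hz hlow).and (hup.and hc)).exists
  have hsub := ((hconv (k j)).le_of_mem_subgradients (hps j) (ws (k j))).trans_lt hj2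
  have hsum := (add_le_add_left hj1.le _).trans_lt hsub
  rw [← EReal.coe_add, EReal.coe_lt_coe_iff] at hsum
  linarith

theorem EpiConverges.ne_top_of_mem_limOut (h : EpiConverges ψs ψ)
    (hconv : ∀ ν, IsConvexFun (ψs ν)) {p : E} (hp : ψ p ≠ ⊤) {z v : E}
    (hzv : (z, v) ∈ limOut fun ν => gphSubgradients (ψs ν)) : ψ z ≠ ⊤ := by
  intro hz
  have hle := h.add_inner_le_of_mem_limOut hconv hzv p
  rw [hz, EReal.top_add_coe, top_le_iff] at hle
  exact hp hle

theorem EpiConverges.limOut_gphSubgradients_subset (h : EpiConverges ψs ψ)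
    (hconv : ∀ ν, IsConvexFun (ψs ν)) (hproper : ∀ ν, IsProper (ψs ν)) {p : E}
    (hbot : ψ p ≠ ⊥) (htop : ψ p ≠ ⊤) :
    limOut (fun ν => gphSubgradients (ψs ν)) ⊆ gphSubgradients ψ := by
  rintro ⟨z, v⟩ hzv
  exact mem_subgradients_of_forall_le (h.ne_bot_of_isConvexFun hconv hproper hbot htop z)
    (h.ne_top_of_mem_limOut hconv htop hzv) (h.add_inner_le_of_mem_limOut hconv hzv)

end EpiLimits

/-! ### Approximate solutions and the relaxed problem -/

section Solutions

variable {m n : ℕ}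

/-- Choosing nearly closest subgradients turns a cluster point of approximate solutions into a
point of the outer limit of the subgradient graphs. -/
theorem mem_limOut_of_mapClusterPt {fs : ℕ → Joint m n → EReal}
    {ys us : ℕ → EuclideanSpace ℝ (Fin m)} {ybar uhat : EuclideanSpace ℝ (Fin m)}
    {xs : ℕ → EuclideanSpace ℝ (Fin n)} {xhat : EuclideanSpace ℝ (Fin n)} {ε : ℕ → ℝ}
    (hys : Tendsto ys atTop (𝓝 ybar)) (hε : Tendsto ε atTop (𝓝 0))
    (hsol : SolvesWithTolerance fs ys ε us xs)
    (hclus : MapClusterPt (uhat, xhat) atTop fun ν => (us ν, xs ν)) :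
    (pair uhat xhat, pair ybar (0 : EuclideanSpace ℝ (Fin n))) ∈
      limOut fun ν => gphSubgradients (fs ν) := by
  have hex : ∀ ν : ℕ, ∃ v ∈ subgradients (fs ν) (pair (us ν) (xs ν)),
      edist (pair (ys ν) (0 : EuclideanSpace ℝ (Fin n))) v <
        ENNReal.ofReal (ε ν) + ENNReal.ofReal (1 / ((ν : ℝ) + 1)) := fun ν =>
    Metric.infEDist_lt_iff.1 ((hsol ν).trans_lt (ENNReal.lt_add_right ENNReal.ofReal_ne_top
      (ENNReal.ofReal_pos.2 (by positivity)).ne'))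
  choose vs hvs hdist using hex
  have hpair : Continuous fun p : EuclideanSpace ℝ (Fin m) × EuclideanSpace ℝ (Fin n) =>
      pair p.1 p.2 := WithLp.prod_continuous_toLp 2 _ _
  have hy0 : Tendsto (fun ν => pair (ys ν) (0 : EuclideanSpace ℝ (Fin n))) atTop
      (𝓝 (pair ybar 0)) :=
    (hpair.tendsto (ybar, 0)).comp (hys.prodMk_nhds tendsto_const_nhds)
  have htol : Tendsto (fun ν : ℕ => ENNReal.ofReal (ε ν) + ENNReal.ofReal (1 / ((ν : ℝ) + 1)))
      atTop (𝓝 0) := by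
    simpa using (ENNReal.tendsto_ofReal hε).add
      (ENNReal.tendsto_ofReal tendsto_one_div_add_atTop_nhds_zero_nat)
  have hedist : Tendsto (fun ν => edist (pair (ys ν) (0 : EuclideanSpace ℝ (Fin n))) (vs ν))
      atTop (𝓝 0) :=
    tendsto_of_tendsto_of_tendsto_of_le_of_le tendsto_const_nhds htol (fun _ => zero_le)
      fun ν => (hdist ν).le
  have hsum := hedist.add (tendsto_iff_edist_tendsto_0.1 hy0)
  rw [add_zero] at hsum
  have hv : Tendsto vs atTop (𝓝 (pair ybar 0)) := by
    refine tendsto_iff_edist_tendsto_0.2 ?_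
    refine tendsto_of_tendsto_of_tendsto_of_le_of_le tendsto_const_nhds hsum
      (fun _ => zero_le) fun ν => ?_
    exact edist_triangle_left (vs ν) (pair ybar (0 : EuclideanSpace ℝ (Fin n)))
      (pair (ys ν) (0 : EuclideanSpace ℝ (Fin n)))
  obtain ⟨k, hk, hlim⟩ := hclus.tendsto_subseq
  exact ⟨k, hk, fun j => (pair (us (k j)) (xs (k j)), vs (k j)), fun j => hvs (k j),
    ((hpair.tendsto _).comp hlim).prodMk_nhds (hv.comp hk.tendsto_atTop)⟩

/-- The global subgradient inequality for `(ybar, 0)` is minimality in the relaxed problem. -/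
theorem mem_argmin_relaxed {f : Joint m n → EReal} {ybar : EuclideanSpace ℝ (Fin m)}
    (ubar : EuclideanSpace ℝ (Fin m)) {z : Joint m n} (hz : f z ≠ ⊤)
    (h : ∀ w, f z + ((inner ℝ (pair ybar (0 : EuclideanSpace ℝ (Fin n))) (w - z) : ℝ) : EReal)
      ≤ f w) : z ∈ argmin (relaxed f ubar ybar) := by
  refine ⟨?_, le_iInf fun w => ?_⟩
  · rw [relaxed, sub_eq_add_neg, ← EReal.coe_neg]
    exact EReal.add_lt_top hz (EReal.coe_ne_top _)
  · have hw := h w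
    have hinner : inner ℝ (pair ybar (0 : EuclideanSpace ℝ (Fin n))) (w - z) =
        -inner ℝ ybar (z.fst - ubar) + inner ℝ ybar (w.fst - ubar) := by
      simp [WithLp.prod_inner_apply, inner_sub_right]
    rw [hinner, EReal.coe_add, ← add_assoc, EReal.coe_neg, ← sub_eq_add_neg] at hw
    exact EReal.le_sub_iff_add_le (Or.inl (EReal.coe_ne_bot _))
      (Or.inl (EReal.coe_ne_top _)) |>.2 hw

end Solutions

end Rockafellian

theorem mainTheorem7 {m n : ℕ}
    (φ : EuclideanSpace ℝ (Fin n) → EReal) (hφ : Rockafellian.IsProper φ)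
    (ys : ℕ → EuclideanSpace ℝ (Fin m)) (ubar ybar : EuclideanSpace ℝ (Fin m))
    (hys : Tendsto ys atTop (𝓝 ybar))
    (ε : ℕ → ℝ) (hε0 : ∀ ν, 0 ≤ ε ν) (hε : Tendsto ε atTop (𝓝 0))
    (f : Rockafellian.Joint m n → EReal)
    (hf : Rockafellian.IsExact f φ ubar ybar)
    (fs : ℕ → Rockafellian.Joint m n → EReal) :
    (Rockafellian.limOut (fun ν => Rockafellian.gphSubgradients (fs ν)) ⊆
        Rockafellian.gphSubgradients f →
      ∀ (us : ℕ → EuclideanSpace ℝ (Fin m)) (xs : ℕ → EuclideanSpace ℝ (Fin n)),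
        Rockafellian.SolvesWithTolerance fs ys ε us xs →
        ∀ (uhat : EuclideanSpace ℝ (Fin m)) (xhat : EuclideanSpace ℝ (Fin n)),
          MapClusterPt (uhat, xhat) atTop (fun ν => (us ν, xs ν)) →
          Rockafellian.pair ybar (0 : EuclideanSpace ℝ (Fin n)) ∈
            Rockafellian.subgradients f (Rockafellian.pair uhat xhat)) ∧
    (Rockafellian.AsymptoticallyStrictlyExact fs f φ ubar ybar →
      (∀ ν, Rockafellian.IsProper (fs ν) ∧ LowerSemicontinuous (fs ν) ∧
        Rockafellian.IsConvexFun (fs ν)) →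
      Rockafellian.limOut (fun ν => Rockafellian.gphSubgradients (fs ν)) ⊆
          Rockafellian.gphSubgradients f ∧
        ∀ (us : ℕ → EuclideanSpace ℝ (Fin m)) (xs : ℕ → EuclideanSpace ℝ (Fin n)),
          Rockafellian.SolvesWithTolerance fs ys ε us xs →
          ∀ (uhat : EuclideanSpace ℝ (Fin m)) (xhat : EuclideanSpace ℝ (Fin n)),
            MapClusterPt (uhat, xhat) atTop (fun ν => (us ν, xs ν)) →
            uhat = ubar ∧ xhat ∈ Rockafellian.argmin φ) := by
  refine ⟨fun hsub us xs hsol uhat xhat hclus =>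
    hsub (Rockafellian.mem_limOut_of_mapClusterPt hys hε hsol hclus), fun hase hfs => ?_⟩
  obtain ⟨hepi, -, hstrict⟩ := hase
  have hconv ν := (hfs ν).2.2
  obtain ⟨⟨x₀, hx₀⟩, hφbot⟩ := hφ
  have htop : f (Rockafellian.pair ubar x₀) ≠ ⊤ := (hf.1 x₀).trans_ne hx₀.ne
  have hbot : f (Rockafellian.pair ubar x₀) ≠ ⊥ := (hf.1 x₀).trans_ne (hφbot x₀).ne'
  refine ⟨hepi.limOut_gphSubgradients_subset hconv (fun ν => (hfs ν).1) hbot htop,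
    fun us xs hsol uhat xhat hclus => hstrict uhat xhat ?_⟩
  have hmem := Rockafellian.mem_limOut_of_mapClusterPt hys hε hsol hclus
  exact Rockafellian.mem_argmin_relaxed ubar (hepi.ne_top_of_mem_limOut hconv htop hmem)
    (hepi.add_inner_le_of_mem_limOut hconv hmem)
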